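/- Let $d\ge 1$, let $\Lambda\subset\mathbb{R}^d$ be a bounded open set, and let $H=L^2(\Lambda)$ with its usual norm. Let $V=W_0^{1,2}(\Lambda)$ be the closure of $C_c^\infty(\Lambda)$ in $W^{1,2}(\Lambda)$, with the norm $\|u\|_V=\big(\int_\Lambda|\nabla u|^2\,dx\big)^{1/2}$, and let $V^*=W^{-1,2}(\Lambda)$ be its dual, with duality pairing $\langle\cdot,\cdot\rangle_V$. For real coefficients $b_i(u)$ on $\Lambda$ that may depend on $u\in V$, the operator $A(u)=\Delta u+\sum_{i=1}^d b_i(u)D_iu$ from $V$ to $V^*$ is understood variationally: $$\langle A(u),w\rangle_V=-\int_\Lambda\nabla u\cdot\nabla w\,dx+\sum_{i=1}^d\int_\Lambda b_i(u)\,D_iu\;w\,dx,\qquad u,w\in V,$$ with all integrands integrable. In (1) and (2) below, $f_1,\dots,f_d:\mathbb{R}\to\mathbb{R}$ are Lipschitz functions and $A(u)=\Delta u+\sum_{i=1}^d f_i(u)D_iu$. In each of (1), (2) and (3), part of the claim is that $A$ is well defined as a map $V\to V^*$, and in (1) and (2) also that $V\subset L^4(\Lambda)$. The constants $K$ do not depend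 on $u,v$. (1) If $d<3$, then there is a constant $K$ such that for all $u,v\in V$ $$2\langle A(u)-A(v),u-v\rangle_V\le-\|u-v\|_V^2+\big(K+K\|u\|_{L^4}^4+K\|v\|_V^2\big)\|u-v\|_H^2 .$$ If moreover all $f_i$ are bounded, then there is a constant $K$ such that for all $u,v\in V$ $$2\langle A(u)-A(v),u-v\rangle_V\le-\|u-v\|_V^2+\big(K+K\|v\|_V^2\big)\|u-v\|_H^2 .$$ (2) If $d=3$, then there is a constant $K$ such that for all $u,v\in V$ $$2\langle A(u)-A(v),u-v\rangle_V\le-\|u-v\|_V^2+\big(K+K\|u\|_{L^4}^8+K\|v\|_V^4\big)\|u-v\|_H^2 .$$ If moreover all $f_i$ are bounded, then there is a constant $K$ such that for all $u,v\in V$ $$2\langle A(u)-A(v),u-v\rangle_V\le-\|u-v\|_V^2+\big(K+K\|v\|_V^4\big)\|u-v\|_H^2 .$$ (3) Let $d\ge1$ be arbitrary, let $f_1,\dots,f_d:\Lambda\to\mathbb{R}$ be bounded measurable functions (independent of $u$), and let $A(u)=\Delta u+\sum_{i=1}^d f_i\,D_iu$. Then there is a constant $K$ such that for all $u,v\in V$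 $$2\langle A(u)-A(v),u-v\rangle_V\le-\|u-v\|_V^2+K\|u-v\|_H^2 .$$ -/

import Mathlib

open MeasureTheory TopologicalSpace
open scoped NNReal ENNReal Distributions

/-- The Euclidean space `ℝ^d`. -/
abbrev Eucl (d : ℕ) : Type := EuclideanSpace ℝ (Fin d)

/-- Lebesgue measure on the open set `Λ ⊆ ℝ^d`. -/
noncomputable abbrev lebOn {d : ℕ} (Λ : Opens (Eucl d)) : Measure (Eucl d) :=
  volume.restrict (Λ : Set (Eucl d))

/-- The space `H = L²(Λ)`. -/
abbrev LTwo {d : ℕ} (Λ : Opens (Eucl d)) : Type := Lp ℝ 2 (lebOn Λ)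

/-- The classical partial derivative `∂φ/∂x_i` at the point `x`. -/
noncomputable def pderiv {d : ℕ} (i : Fin d) (φ : Eucl d → ℝ) (x : Eucl d) : ℝ :=
  fderiv ℝ φ x (EuclideanSpace.single i 1)

/-- `g` is the weak partial derivative `D_i u` of `u` on `Λ`: for every test function
`φ ∈ C_c^∞(Λ)` one has `∫_Λ u ∂_i φ dx = - ∫_Λ g φ dx`. -/
def IsWeakPDeriv {d : ℕ} (Λ : Opens (Eucl d)) (i : Fin d) (u g : LTwo Λ) : Prop :=
  ∀ φ : 𝓓(Λ, ℝ), ∫ x, u x * pderiv i φ x ∂(lebOn Λ) = - ∫ x, g x * φ x ∂(lebOn Λ)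

theorem pderiv_memLp {d : ℕ} (Λ : Opens (Eucl d)) (i : Fin d) (φ : 𝓓(Λ, ℝ)) :
    MemLp (pderiv i φ) 2 (lebOn Λ) := by
  have h1 : ContDiff ℝ 1 φ := φ.contDiff.of_le (by exact_mod_cast le_top)
  have hc : Continuous (pderiv i φ) := (h1.continuous_fderiv one_ne_zero).clm_apply continuous_const
  exact hc.memLp_of_hasCompactSupport
    (φ.hasCompactSupport.fderiv_apply ℝ (EuclideanSpace.single i 1))

theorem testFun_memLp {d : ℕ} (Λ : Opens (Eucl d)) (φ : 𝓓(Λ, ℝ)) : MemLp φ 2 (lebOn Λ) :=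
  φ.continuous.memLp_of_hasCompactSupport φ.hasCompactSupport

theorem IsWeakPDeriv.zero {d : ℕ} (Λ : Opens (Eucl d)) (i : Fin d) : IsWeakPDeriv Λ i 0 0 := by
  intro φ
  have h : (fun x => (0 : LTwo Λ) x * pderiv i φ x) =ᵐ[lebOn Λ] 0 := by
    filter_upwards [Lp.coeFn_zero ℝ 2 (lebOn Λ)] with x hx
    rw [hx]; simp
  have h' : (fun x => (0 : LTwo Λ) x * φ x) =ᵐ[lebOn Λ] 0 := by
    filter_upwards [Lp.coeFn_zero ℝ 2 (lebOn Λ)] with x hx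
    rw [hx]; simp
  rw [integral_congr_ae h, integral_congr_ae h']
  simp

theorem IsWeakPDeriv.add {d : ℕ} {Λ : Opens (Eucl d)} {i : Fin d} {u g v h : LTwo Λ}
    (hu : IsWeakPDeriv Λ i u g) (hv : IsWeakPDeriv Λ i v h) :
    IsWeakPDeriv Λ i (u + v) (g + h) := by
  intro φ
  have key : ∀ (a b : LTwo Λ) (ψ : Eucl d → ℝ), MemLp ψ 2 (lebOn Λ) →
      ∫ x, (a + b) x * ψ x ∂(lebOn Λ) =
        ∫ x, a x * ψ x ∂(lebOn Λ) + ∫ x, b x * ψ x ∂(lebOn Λ) := by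
    intro a b ψ hψ
    have ha : Integrable (fun x => a x * ψ x) (lebOn Λ) := (Lp.memLp a).integrable_mul hψ
    have hb : Integrable (fun x => b x * ψ x) (lebOn Λ) := (Lp.memLp b).integrable_mul hψ
    rw [← integral_add ha hb]
    apply integral_congr_ae
    filter_upwards [Lp.coeFn_add a b] with x hx
    rw [hx, Pi.add_apply, add_mul]
  rw [key _ _ _ (pderiv_memLp Λ i φ), key _ _ _ (testFun_memLp Λ φ), hu φ, hv φ]
  ring

theorem IsWeakPDeriv.smul {d : ℕ} {Λ : Opens (Eucl d)} {i : Fin d} {u g : LTwo Λ} (c : ℝ)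
    (hu : IsWeakPDeriv Λ i u g) : IsWeakPDeriv Λ i (c • u) (c • g) := by
  intro φ
  have key : ∀ (a : LTwo Λ) (ψ : Eucl d → ℝ),
      ∫ x, (c • a) x * ψ x ∂(lebOn Λ) = c * ∫ x, a x * ψ x ∂(lebOn Λ) := by
    intro a ψ
    rw [← integral_const_mul]
    apply integral_congr_ae
    filter_upwards [Lp.coeFn_smul c a] with x hx
    simp [hx, mul_assoc]
  rw [key, key, hu φ]
  ring

/-- The Sobolev space `W^{1,2}(Λ)`: a function `u ∈ L²(Λ)` together with its weak partial
derivatives `D_1 u, …, D_d u ∈ L²(Λ)` (which `u` determines), with the topology of the norm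
`‖u‖_{L²} + ‖∇u‖_{L²}`. -/
noncomputable def SobolevW {d : ℕ} (Λ : Opens (Eucl d)) : Submodule ℝ (LTwo Λ × (Fin d → LTwo Λ)) where
  carrier := {p | ∀ i, IsWeakPDeriv Λ i p.1 (p.2 i)}
  zero_mem' i := IsWeakPDeriv.zero Λ i
  add_mem' hp hq i := (hp i).add (hq i)
  smul_mem' c _ hp i := (hp i).smul c

/-- The elements of `W^{1,2}(Λ)` given by the test functions, i.e. `C_c^∞(Λ)` as a subspace of
`W^{1,2}(Λ)`. -/
noncomputable def testSubspace {d : ℕ} (Λ : Opens (Eucl d)) :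
    Submodule ℝ (LTwo Λ × (Fin d → LTwo Λ)) where
  carrier := {p | p ∈ SobolevW Λ ∧ ∃ φ : 𝓓(Λ, ℝ), p.1 =ᵐ[lebOn Λ] φ}
  zero_mem' := ⟨(SobolevW Λ).zero_mem, 0, Lp.coeFn_zero ℝ 2 (lebOn Λ)⟩
  add_mem' := by
    rintro p q ⟨hp, φ, hφ⟩ ⟨hq, ψ, hψ⟩
    refine ⟨(SobolevW Λ).add_mem hp hq, φ + ψ, ?_⟩
    filter_upwards [hφ, hψ, Lp.coeFn_add p.1 q.1] with x h1 h2 h3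
    simpa [h1, h2] using h3
  smul_mem' := by
    rintro c p ⟨hp, φ, hφ⟩
    refine ⟨(SobolevW Λ).smul_mem c hp, c • φ, ?_⟩
    filter_upwards [hφ, Lp.coeFn_smul c p.1] with x h1 h2
    simpa [h1] using h2

/-- The space `V = W_0^{1,2}(Λ)`: the closure of `C_c^∞(Λ)` in `W^{1,2}(Λ)`. -/
noncomputable def SobolevWZero {d : ℕ} (Λ : Opens (Eucl d)) :
    Submodule ℝ (LTwo Λ × (Fin d → LTwo Λ)) :=
  SobolevW Λ ⊓ (testSubspace Λ).topologicalClosure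

/-- The dual space `V^* = W^{-1,2}(Λ)` of `V = W_0^{1,2}(Λ)`; for `a ∈ V^*` and `w ∈ V` the duality
pairing `⟨a, w⟩_V` is the application `a w`. -/
abbrev SobolevDual {d : ℕ} (Λ : Opens (Eucl d)) : Type := StrongDual ℝ (SobolevWZero Λ)

/-- The inclusion `V ⊆ H`, where `V = W_0^{1,2}(Λ)` and `H = L²(Λ)`. -/
noncomputable def toL2 {d : ℕ} {Λ : Opens (Eucl d)} (u : SobolevWZero Λ) : LTwo Λ := u.1.1

/-- The weak partial derivative `D_i u` of `u ∈ W_0^{1,2}(Λ)`. -/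
noncomputable def wD {d : ℕ} {Λ : Opens (Eucl d)} (i : Fin d) (u : SobolevWZero Λ) : LTwo Λ := u.1.2 i

/-- The norm `‖u‖_V = (∫_Λ |∇u|² dx)^{1/2}` of `V = W_0^{1,2}(Λ)`. -/
noncomputable def normV {d : ℕ} {Λ : Opens (Eucl d)} (u : SobolevWZero Λ) : ℝ :=
  Real.sqrt (∫ x, ∑ i, (wD i u x) ^ 2 ∂(lebOn Λ))

/-- The norm `‖u‖_H` of `H = L²(Λ)`. -/
noncomputable def normH {d : ℕ} {Λ : Opens (Eucl d)} (u : SobolevWZero Λ) : ℝ := ‖toL2 u‖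

/-- The norm `‖u‖_{L⁴}` of a function `u` that lies in `L⁴(Λ)`. -/
noncomputable def normLFour {d : ℕ} {Λ : Opens (Eucl d)} (u : SobolevWZero Λ) : ℝ :=
  (eLpNorm (toL2 u) 4 (lebOn Λ)).toReal

/-- `A : V → V^*` is the operator `A(u) = Δu + ∑_i b_i(u) D_i u` in its variational form, where the
coefficient `b_i(u)` is a function on `Λ` that may depend on `u ∈ V`: for all `u, w ∈ V` the
functions `b_i(u) D_i u w` are integrable over `Λ`, and
`⟨A(u), w⟩_V = - ∫_Λ ∇u · ∇w dx + ∑_i ∫_Λ b_i(u) D_i u w dx`.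
This determines `A`. -/
def IsDriftLaplacian {d : ℕ} (Λ : Opens (Eucl d)) (b : SobolevWZero Λ → Fin d → Eucl d → ℝ)
    (A : SobolevWZero Λ → SobolevDual Λ) : Prop :=
  ∀ u w : SobolevWZero Λ,
    (∀ i, Integrable (fun x => b u i x * wD i u x * toL2 w x) (lebOn Λ)) ∧
    A u w = - (∫ x, ∑ i, wD i u x * wD i w x ∂(lebOn Λ)) +
      ∑ i, ∫ x, b u i x * wD i u x * toL2 w x ∂(lebOn Λ)

open Filter Topology

/-! ### Interpolation inequalities for compactly supported functions -/

/-! Put w = u - v. Twice the Laplacian part gives -2‖w‖_V². The drift difference splits as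
f_i(u)D_iw + (f_i(u) - f_i(v))D_iv. After multiplication by 2w, Young's inequality bounds the first
piece by ½|D_iw|² + 2f_i(u)²w² and the Lipschitz condition bounds the second by 2L|D_iv|w²
(`two_mul_drift_sub_le`). Since f_i(u)² ≤ α + βu², Hölder's inequality leaves, besides multiples of
‖w‖_H², only terms t‖w‖_{L⁴}² with t a multiple of β‖u‖_{L⁴}² or of ‖v‖_V.

These are absorbed by interpolation: ‖w‖_{L⁴}⁴ ≤ C‖w‖_H²‖w‖_V² for d < 3 and ‖w‖_{L⁴}⁸ ≤
C‖w‖_H²‖w‖_V⁶ for d = 3. Young's inequality turns them into t‖w‖_{L⁴}² ≤ ε‖w‖_V² + K t^k ‖w‖_H² with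
k = 2 or k = 4 (`LFourAbsorption`), which is the source of the exponents in the claim. Bounded f_i
allow β = 0, so the L⁴ norm of u drops out. Coefficients independent of u have no second piece, so
no interpolation and no restriction on d is needed.

The interpolation inequalities are proved for test functions and carried to V by lower
semicontinuity of the L⁴ norm. The same L⁴ bounds show that A maps into V^*. -/

theorem sq_lintegral_mul_le {α : Type*} [MeasurableSpace α] (μ : Measure α) {f g : α → ℝ≥0∞}
    (hf : AEMeasurable f μ) (hg : AEMeasurable g μ) :
    (∫⁻ x, f x * g x ∂μ) ^ 2 ≤ (∫⁻ x, f x ^ 2 ∂μ) * ∫⁻ x, g x ^ 2 ∂μ := by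
  have h := ENNReal.lintegral_mul_le_Lp_mul_Lq μ Real.HolderConjugate.two_two hf hg
  simp only [Pi.mul_apply, ENNReal.rpow_ofNat] at h
  have key : ∀ a : ℝ≥0∞, (a ^ (1 / 2 : ℝ)) ^ 2 = a := fun a => by
    rw [← ENNReal.rpow_natCast, ← ENNReal.rpow_mul]; norm_num
  calc _ ≤ _ := pow_le_pow_left' h 2
    _ = _ := by rw [mul_pow, key, key]

/-- In dimension one, a compactly supported function is bounded by the integral of its
derivative. -/
theorem enorm_le_lintegral_fderiv_one {φ : Eucl 1 → ℝ} (hφ : ContDiff ℝ 1 φ)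
    (hc : HasCompactSupport φ) (x : Eucl 1) : ‖φ x‖ₑ ≤ ∫⁻ y, ‖fderiv ℝ φ y‖ₑ := by
  let e : ℝ → Eucl 1 := fun t => EuclideanSpace.single 0 t
  have he : ∀ t, e t = t • EuclideanSpace.single (0 : Fin 1) (1 : ℝ) := fun t => by
    ext i; simp [e]
  have hes : ∀ y : Eucl 1, e (y 0) = y := fun y => by
    ext i; fin_cases i; simp [e]
  have hmp : MeasurePreserving (fun y : Eucl 1 => y 0) volume volume :=
    (volume_preserving_funUnique (Fin 1) ℝ).comp (PiLp.volume_preserving_ofLp (Fin 1))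
  have hder : ∀ t, HasDerivAt e (EuclideanSpace.single (0 : Fin 1) (1 : ℝ)) t := fun t => by
    have h2 := (hasDerivAt_id t).smul_const (EuclideanSpace.single (0 : Fin 1) (1 : ℝ))
    rw [one_smul] at h2
    exact h2.congr_of_eventuallyEq (Eventually.of_forall he)
  have hcd : ContDiff ℝ 1 e := by
    rw [funext he]; fun_prop
  have hcl : Topology.IsClosedEmbedding e := by
    have hiso : Isometry e := by
      refine Isometry.of_dist_eq fun s t => ?_
      simp [e]
    exact hiso.isClosedEmbedding
  have hcs : HasCompactSupport (φ ∘ e) := hc.comp_isClosedEmbedding hcl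
  have h1 := HasCompactSupport.enorm_le_lintegral_Ici_deriv (hφ.comp hcd) hcs (x 0)
  rw [Function.comp_apply, hes] at h1
  refine h1.trans ((setLIntegral_le_lintegral _ _).trans ?_)
  have hm : Measurable fun t : ℝ => ‖fderiv ℝ φ (e t)‖ₑ :=
    ((hφ.continuous_fderiv one_ne_zero).comp hcd.continuous).enorm.measurable
  calc ∫⁻ t, ‖deriv (φ ∘ e) t‖ₑ ≤ ∫⁻ t, ‖fderiv ℝ φ (e t)‖ₑ := by
        refine lintegral_mono fun t => ?_
        have h3 : HasDerivAt (φ ∘ e) (fderiv ℝ φ (e t) (EuclideanSpace.single 0 1)) t :=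
          ((hφ.differentiable one_ne_zero).differentiableAt.hasFDerivAt).comp_hasDerivAt t (hder t)
        rw [h3.deriv]
        refine (ContinuousLinearMap.le_opENorm _ _).trans ?_
        simp [enorm]
    _ = ∫⁻ y : Eucl 1, ‖fderiv ℝ φ (e (y 0))‖ₑ := (hmp.lintegral_comp hm).symm
    _ = _ := by simp_rw [hes]

/-- |φ|⁴ ≤ (sup|φ|)²|φ|², where sup|φ| ≤ ∫|φ'|; Cauchy–Schwarz on the support of φ costs the factor
|Λ|. -/
theorem lintegral_enorm_pow_four_le_one {Λ : Set (Eucl 1)} {φ : Eucl 1 → ℝ}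
    (hφ : ContDiff ℝ 1 φ) (hc : HasCompactSupport φ) (hs : tsupport φ ⊆ Λ) :
    ∫⁻ x, ‖φ x‖ₑ ^ 4 ≤
      volume Λ * ((∫⁻ x, ‖φ x‖ₑ ^ 2) * ∫⁻ x, ‖fderiv ℝ φ x‖ₑ ^ 2) := by
  have hm : Measurable fun x => ‖fderiv ℝ φ x‖ₑ :=
    (hφ.continuous_fderiv one_ne_zero).enorm.measurable
  have h0 : ∀ x ∉ tsupport φ, ‖fderiv ℝ φ x‖ₑ = 0 := fun x hx => by
    rw [← ofReal_norm, fderiv_of_notMem_tsupport ℝ hx, norm_zero, ENNReal.ofReal_zero]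
  have h1 : (∫⁻ x, ‖fderiv ℝ φ x‖ₑ) ^ 2 ≤ volume Λ * ∫⁻ x, ‖fderiv ℝ φ x‖ₑ ^ 2 := by
    -- `Λ` is an arbitrary set here, so the indicator is that of the closed, hence measurable, set
    -- `tsupport φ`.
    have h2 := sq_lintegral_mul_le volume
      (f := (tsupport φ).indicator 1) (g := fun x => ‖fderiv ℝ φ x‖ₑ)
      ((measurable_one.indicator (isClosed_tsupport φ).measurableSet).aemeasurable)
      hm.aemeasurable
    have h3 : ∀ x, (tsupport φ).indicator 1 x * ‖fderiv ℝ φ x‖ₑ = ‖fderiv ℝ φ x‖ₑ := fun x => by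
      by_cases hx : x ∈ tsupport φ
      · simp [hx]
      · simp [h0 x hx]
    have h4 : ∀ x, ((tsupport φ).indicator 1 x : ℝ≥0∞) ^ 2 = (tsupport φ).indicator 1 x :=
      fun x => by by_cases hx : x ∈ tsupport φ <;> simp [hx]
    simp_rw [h3, h4] at h2
    rw [lintegral_indicator_one (isClosed_tsupport φ).measurableSet] at h2
    exact h2.trans (by gcongr)
  calc ∫⁻ x, ‖φ x‖ₑ ^ 4 ≤ ∫⁻ x, (∫⁻ y, ‖fderiv ℝ φ y‖ₑ) ^ 2 * ‖φ x‖ₑ ^ 2 := by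
        refine lintegral_mono fun x => ?_
        rw [show (4 : ℕ) = 2 + 2 from rfl, pow_add]
        gcongr
        exact enorm_le_lintegral_fderiv_one hφ hc x
    _ = (∫⁻ y, ‖fderiv ℝ φ y‖ₑ) ^ 2 * ∫⁻ x, ‖φ x‖ₑ ^ 2 :=
        lintegral_const_mul _ (hφ.continuous.enorm.measurable.pow_const 2)
    _ ≤ (volume Λ * ∫⁻ x, ‖fderiv ℝ φ x‖ₑ ^ 2) * ∫⁻ x, ‖φ x‖ₑ ^ 2 := by gcongr
    _ = _ := by ring

/-- **Ladyzhenskaya's inequality** in dimension two. -/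
theorem exists_lintegral_enorm_pow_four_le_two : ∃ C : ℝ≥0, ∀ φ : Eucl 2 → ℝ, ContDiff ℝ 1 φ →
    HasCompactSupport φ → ∫⁻ x, ‖φ x‖ₑ ^ 4 ≤
      C * ((∫⁻ x, ‖φ x‖ₑ ^ 2) * ∫⁻ x, ‖fderiv ℝ φ x‖ₑ ^ 2) := by
  refine ⟨lintegralPowLePowLIntegralFDerivConst (volume : Measure (Eucl 2)) 2 * 4,
    fun φ hφ hc => ?_⟩
  have hp : Real.HolderConjugate (Module.finrank ℝ (Eucl 2)) 2 := by
    rw [finrank_euclideanSpace_fin]; exact_mod_cast Real.HolderConjugate.two_two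
  -- The Gagliardo–Nirenberg–Sobolev inequality ‖g‖_{L²} ≤ C‖∇g‖_{L¹} for g = φ². Since |∇φ²| =
  -- 2|φ||∇φ|, squaring produces the factor 4 in the constant.
  have h1 := lintegral_pow_le_pow_lintegral_fderiv volume (u := fun x => φ x * φ x)
    (hφ.mul hφ) (hc.mul_left) hp
  have h2 : ∀ x, ‖fderiv ℝ (fun x => φ x * φ x) x‖ₑ = 2 * (‖φ x‖ₑ * ‖fderiv ℝ φ x‖ₑ) := fun x => by
    have hd := (hφ.differentiable one_ne_zero).differentiableAt (x := x)
    rw [fderiv_fun_mul hd hd, ← two_smul ℝ (φ x • fderiv ℝ φ x), enorm_smul, enorm_smul]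
    congr 1
    rw [← ofReal_norm]; simp
  simp_rw [h2, ENNReal.rpow_ofNat] at h1
  have hm : Measurable fun x => ‖fderiv ℝ φ x‖ₑ :=
    (hφ.continuous_fderiv one_ne_zero).enorm.measurable
  have hm' : Measurable fun x => ‖φ x‖ₑ := hφ.continuous.enorm.measurable
  rw [lintegral_const_mul 2 (f := fun x => ‖φ x‖ₑ * ‖fderiv ℝ φ x‖ₑ) (hm'.mul hm)] at h1
  have h3 := sq_lintegral_mul_le volume hm'.aemeasurable hm.aemeasurable
  calc ∫⁻ x, ‖φ x‖ₑ ^ 4 = ∫⁻ x, ‖φ x * φ x‖ₑ ^ 2 := by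
        refine lintegral_congr fun x => ?_
        rw [enorm_mul]; ring
    _ ≤ _ := h1
    _ = ↑(lintegralPowLePowLIntegralFDerivConst (volume : Measure (Eucl 2)) 2) * 4 *
          (∫⁻ x, ‖φ x‖ₑ * ‖fderiv ℝ φ x‖ₑ) ^ 2 := by ring
    _ ≤ _ := by push_cast; gcongr

/-- **Ladyzhenskaya's inequality** in dimension three. -/
theorem exists_sq_lintegral_enorm_pow_four_le_three : ∃ C : ℝ≥0, ∀ φ : Eucl 3 → ℝ, ContDiff ℝ 1 φ →
    HasCompactSupport φ → (∫⁻ x, ‖φ x‖ₑ ^ 4) ^ 2 ≤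
      C * ((∫⁻ x, ‖φ x‖ₑ ^ 2) * (∫⁻ x, ‖fderiv ℝ φ x‖ₑ ^ 2) ^ 3) := by
  refine ⟨SNormLESNormFDerivOfEqConst ℝ (volume : Measure (Eucl 3)) 2 ^ 6,
    fun φ hφ hc => ?_⟩
  -- Sobolev's inequality with 1/6 = 1/2 - 1/3. It combines with Cauchy–Schwarz for φ⁴ = φ·φ³, which
  -- leaves the integral of φ⁶.
  have h1 := eLpNorm_le_eLpNorm_fderiv_of_eq (volume : Measure (Eucl 3)) hφ hc (p := 2) (p' := 6)
    (by norm_num) (by simp) (by rw [finrank_euclideanSpace_fin]; norm_num)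
  have h6 := eLpNorm_nnreal_pow_eq_lintegral (f := φ) (μ := volume) (p := 6) (by norm_num)
  have h2 := eLpNorm_nnreal_pow_eq_lintegral (f := fderiv ℝ φ) (μ := volume) (p := 2) (by norm_num)
  simp only [NNReal.coe_ofNat, ENNReal.rpow_ofNat, ENNReal.coe_ofNat] at h6 h2
  have hm' : Measurable fun x => ‖φ x‖ₑ := hφ.continuous.enorm.measurable
  have h3 := sq_lintegral_mul_le volume hm'.aemeasurable (hm'.pow_const 3).aemeasurable
  have h4 : ∫⁻ x, (‖φ x‖ₑ ^ 3) ^ 2 = ∫⁻ x, ‖φ x‖ₑ ^ 6 := by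
    refine lintegral_congr fun x => ?_
    rw [← pow_mul]
  calc (∫⁻ x, ‖φ x‖ₑ ^ 4) ^ 2 = (∫⁻ x, ‖φ x‖ₑ * ‖φ x‖ₑ ^ 3) ^ 2 := by
        congr 1; refine lintegral_congr fun x => ?_
        ring
    _ ≤ _ := h3
    _ ≤ (∫⁻ x, ‖φ x‖ₑ ^ 2) * (SNormLESNormFDerivOfEqConst ℝ (volume : Measure (Eucl 3)) 2 *
          eLpNorm (fderiv ℝ φ) 2 volume) ^ 6 := by
        rw [h4, ← h6]; gcongr; exact h1
    _ = _ := by rw [← h2]; push_cast; ring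

/-! ### Elements of `W₀^{1,2}` as limits of test functions -/

/-- The fundamental lemma of the calculus of variations, which makes weak derivatives unique. -/
theorem eq_zero_of_forall_integral_testFun_eq_zero {d : ℕ} {Λ : Opens (Eucl d)} {g : Eucl d → ℝ}
    (hg : MemLp g 2 (lebOn Λ)) (h : ∀ φ : 𝓓(Λ, ℝ), ∫ x, g x * φ x ∂(lebOn Λ) = 0) :
    g =ᵐ[lebOn Λ] 0 := by
  have hloc : LocallyIntegrableOn g (Λ : Set (Eucl d)) volume :=
    (locallyIntegrableOn_of_locallyIntegrable_restrict (hg.locallyIntegrable one_le_two))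
  have := Λ.isOpen.ae_eq_zero_of_integral_contDiff_smul_eq_zero hloc fun ψ hψ hc hs => by
    have h1 := h ⟨ψ, by exact_mod_cast hψ, hc, hs⟩
    change ∫ x, g x * ψ x ∂(lebOn Λ) = 0 at h1
    rw [setIntegral_eq_integral_of_forall_compl_eq_zero] at h1
    · simpa [mul_comm] using h1
    · intro x hx
      rw [image_eq_zero_of_notMem_tsupport fun hx' => hx (hs hx'), mul_zero]
  exact (ae_restrict_iff' Λ.isOpen.measurableSet).2 this

/-- Integration by parts on ℝ^d and uniqueness of weak derivatives. It is needed because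
`testSubspace` ties only the first component of a pair to a test function; the gradient component
has to be identified. -/
theorem IsWeakPDeriv.ae_eq_pderiv {d : ℕ} {Λ : Opens (Eucl d)} {i : Fin d} {u g : LTwo Λ}
    (h : IsWeakPDeriv Λ i u g) {φ : 𝓓(Λ, ℝ)} (hφ : u =ᵐ[lebOn Λ] φ) :
    g =ᵐ[lebOn Λ] pderiv i φ := by
  have hz : (fun x => g x - pderiv i φ x) =ᵐ[lebOn Λ] 0 := by
    refine eq_zero_of_forall_integral_testFun_eq_zero
      ((Lp.memLp g).sub (pderiv_memLp Λ i φ)) fun ψ => ?_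
    have i1 : Integrable (fun x => g x * ψ x) (lebOn Λ) :=
      (Lp.memLp g).integrable_mul (testFun_memLp Λ ψ)
    have i2 : Integrable (fun x => pderiv i φ x * ψ x) (lebOn Λ) :=
      (pderiv_memLp Λ i φ).integrable_mul (testFun_memLp Λ ψ)
    simp_rw [sub_mul]
    rw [integral_sub i1 i2, sub_eq_zero]
    have h1 := h ψ
    have h2 : ∫ x, u x * pderiv i ψ x ∂(lebOn Λ) = ∫ x, φ x * pderiv i ψ x ∂(lebOn Λ) := by
      refine integral_congr_ae ?_
      filter_upwards [hφ] with x hx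
      rw [hx]
    have cφ : ContDiff ℝ 1 φ := φ.contDiff.of_le (by exact_mod_cast le_top)
    have cψ : ContDiff ℝ 1 ψ := ψ.contDiff.of_le (by exact_mod_cast le_top)
    have kφ : Continuous (pderiv i φ) :=
      (cφ.continuous_fderiv one_ne_zero).clm_apply continuous_const
    have kψ : Continuous (pderiv i ψ) :=
      (cψ.continuous_fderiv one_ne_zero).clm_apply continuous_const
    have h3 : ∫ x, φ x * pderiv i ψ x = - ∫ x, pderiv i φ x * ψ x := by
      refine integral_mul_fderiv_eq_neg_fderiv_mul_of_integrable ?_ ?_ ?_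
        (fun x _ => (cφ.differentiable one_ne_zero).differentiableAt)
        (fun x _ => (cψ.differentiable one_ne_zero).differentiableAt)
      · exact (kφ.mul ψ.continuous).integrable_of_hasCompactSupport ψ.hasCompactSupport.mul_left
      · exact (φ.continuous.mul kψ).integrable_of_hasCompactSupport φ.hasCompactSupport.mul_right
      · exact (φ.continuous.mul ψ.continuous).integrable_of_hasCompactSupport
          φ.hasCompactSupport.mul_right
    -- The supports lie in Λ, so the integrals over Λ are integrals over ℝ^d and no boundary term
    -- arises.
    have h4 : ∫ x, φ x * pderiv i ψ x ∂(lebOn Λ) = ∫ x, φ x * pderiv i ψ x :=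
      setIntegral_eq_integral_of_forall_compl_eq_zero fun x hx => by
        rw [image_eq_zero_of_notMem_tsupport fun hx' => hx (φ.tsupport_subset hx'), zero_mul]
    have h5 : ∫ x, pderiv i φ x * ψ x ∂(lebOn Λ) = ∫ x, pderiv i φ x * ψ x :=
      setIntegral_eq_integral_of_forall_compl_eq_zero fun x hx => by
        rw [image_eq_zero_of_notMem_tsupport fun hx' => hx (ψ.tsupport_subset hx'), mul_zero]
    linarith
  filter_upwards [hz] with x hx
  exact sub_eq_zero.1 hx

theorem norm_fderiv_le_sum_pderiv {d : ℕ} (φ : Eucl d → ℝ) (x : Eucl d) :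
    ‖fderiv ℝ φ x‖ ≤ ∑ i, ‖pderiv i φ x‖ := by
  refine ContinuousLinearMap.opNorm_le_bound _ (by positivity) fun y => ?_
  have hy : y = ∑ i, y i • EuclideanSpace.single i (1 : ℝ) := by
    ext j; simp [Finset.sum_apply, Pi.single_apply]
  conv_lhs => rw [hy]
  rw [map_sum, Finset.sum_mul]
  refine (norm_sum_le _ _).trans (Finset.sum_le_sum fun i _ => ?_)
  rw [map_smul, norm_smul, mul_comm]
  gcongr
  · rfl
  · exact PiLp.norm_apply_le y i

theorem lintegral_enorm_sq_eq {α E : Type*} [MeasurableSpace α] [NormedAddCommGroup E]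
    {μ : Measure α} {f : α → E} : ∫⁻ x, ‖f x‖ₑ ^ 2 ∂μ = eLpNorm f 2 μ ^ 2 := by
  have := eLpNorm_nnreal_pow_eq_lintegral (f := f) (μ := μ) (p := 2) (by norm_num)
  simpa using this.symm

theorem lintegral_enorm_pow_four_eq {α E : Type*} [MeasurableSpace α] [NormedAddCommGroup E]
    {μ : Measure α} {f : α → E} : ∫⁻ x, ‖f x‖ₑ ^ 4 ∂μ = eLpNorm f 4 μ ^ 4 := by
  have := eLpNorm_nnreal_pow_eq_lintegral (f := f) (μ := μ) (p := 4) (by norm_num)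
  simpa using this.symm

theorem lintegral_enorm_pow_restrict_eq {d : ℕ} {Λ : Opens (Eucl d)} {E : Type*}
    [NormedAddCommGroup E] {f : Eucl d → E} (hf : ∀ x ∉ Λ, f x = 0) {n : ℕ} (hn : n ≠ 0) :
    ∫⁻ x, ‖f x‖ₑ ^ n ∂(lebOn Λ) = ∫⁻ x, ‖f x‖ₑ ^ n := by
  refine setLIntegral_eq_of_support_subset fun x hx => ?_
  by_contra hx'
  exact hx (by simp [hf x hx', hn])

/-- The data of a test function `φ` with class `p` in `W^{1,2}(Λ)`. -/
theorem exists_testFun_of_mem_testSubspace {d : ℕ} {Λ : Opens (Eucl d)}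
    {p : LTwo Λ × (Fin d → LTwo Λ)} (hp : p ∈ testSubspace Λ) :
    ∃ φ : 𝓓(Λ, ℝ), ∫⁻ x, ‖φ x‖ₑ ^ 4 = eLpNorm p.1 4 (lebOn Λ) ^ 4 ∧
      ∫⁻ x, ‖φ x‖ₑ ^ 2 = ENNReal.ofReal (‖p.1‖ ^ 2) ∧
      ∫⁻ x, ‖fderiv ℝ φ x‖ₑ ^ 2 ≤ ENNReal.ofReal ((∑ i, ‖p.2 i‖) ^ 2) := by
  obtain ⟨hw, φ, hφ⟩ := hp
  have h0 : ∀ x ∉ Λ, φ x = 0 := fun x hx =>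
    image_eq_zero_of_notMem_tsupport fun hx' => hx (φ.tsupport_subset hx')
  have h0' : ∀ x ∉ Λ, fderiv ℝ φ x = 0 := fun x hx =>
    fderiv_of_notMem_tsupport ℝ fun hx' => hx (φ.tsupport_subset hx')
  refine ⟨φ, ?_, ?_, ?_⟩
  · rw [← lintegral_enorm_pow_restrict_eq h0 four_ne_zero, lintegral_enorm_pow_four_eq,
      eLpNorm_congr_ae hφ]
  · rw [← lintegral_enorm_pow_restrict_eq h0 two_ne_zero, lintegral_enorm_sq_eq,
      ← eLpNorm_congr_ae hφ, ENNReal.ofReal_pow (norm_nonneg _), ofReal_norm, Lp.enorm_def]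
  · rw [← lintegral_enorm_pow_restrict_eq h0' two_ne_zero, lintegral_enorm_sq_eq,
      ENNReal.ofReal_pow (by positivity), ENNReal.ofReal_sum_of_nonneg fun _ _ => norm_nonneg _]
    gcongr
    have hc : ∀ i, AEStronglyMeasurable (fun x => ‖pderiv i φ x‖) (lebOn Λ) :=
      fun i => (pderiv_memLp Λ i φ).1.norm
    calc eLpNorm (fderiv ℝ φ) 2 (lebOn Λ)
        ≤ eLpNorm (∑ i, fun x => ‖pderiv i φ x‖) 2 (lebOn Λ) := by
          refine eLpNorm_mono_real fun x => ?_
          rw [Finset.sum_apply]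
          exact norm_fderiv_le_sum_pderiv φ x
      _ ≤ ∑ i, eLpNorm (fun x => ‖pderiv i φ x‖) 2 (lebOn Λ) :=
          eLpNorm_sum_le (fun i _ => hc i) one_le_two
      _ = ∑ i, ENNReal.ofReal ‖p.2 i‖ := by
          refine Finset.sum_congr rfl fun i _ => ?_
          rw [eLpNorm_norm, ofReal_norm, Lp.enorm_def,
            eLpNorm_congr_ae ((hw i).ae_eq_pderiv hφ)]

/-- An `L⁴` bound by a continuous function of the `W^{1,2}` data passes from test functions to
their closure. -/
theorem eLpNorm_four_le_of_mem_closure {d : ℕ} {Λ : Opens (Eucl d)} {F : ℝ → ℝ → ℝ}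
    (hF : Continuous fun q : ℝ × ℝ => F q.1 q.2)
    (h : ∀ p ∈ testSubspace Λ,
      eLpNorm p.1 4 (lebOn Λ) ≤ ENNReal.ofReal (F ‖p.1‖ (∑ i, ‖p.2 i‖)))
    {p : LTwo Λ × (Fin d → LTwo Λ)} (hp : p ∈ (testSubspace Λ).topologicalClosure) :
    eLpNorm p.1 4 (lebOn Λ) ≤ ENNReal.ofReal (F ‖p.1‖ (∑ i, ‖p.2 i‖)) := by
  obtain ⟨s, hs, hlim⟩ := mem_closure_iff_seq_limit.1 hp
  have hlim1 : Tendsto (fun n => (s n).1) atTop (𝓝 p.1) := (continuous_fst.tendsto p).comp hlim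
  -- L² convergence gives an a.e. convergent subsequence. Fatou's lemma then bounds the L⁴ norm of
  -- the limit, which is not known to be finite beforehand.
  obtain ⟨ns, hns, hae⟩ := (tendstoInMeasure_of_tendsto_Lp hlim1).exists_seq_tendsto_ae
  refine (Lp.eLpNorm_lim_le_liminf_eLpNorm (fun n => (Lp.memLp (s (ns n)).1).1) _ hae).trans ?_
  have hG : Continuous fun p : LTwo Λ × (Fin d → LTwo Λ) =>
      ENNReal.ofReal (F ‖p.1‖ (∑ i, ‖p.2 i‖)) :=
    ENNReal.continuous_ofReal.comp (hF.comp (by fun_prop :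
      Continuous fun p : LTwo Λ × (Fin d → LTwo Λ) => (‖p.1‖, ∑ i, ‖p.2 i‖)))
  have hG' := ((hG.tendsto p).comp hlim).comp hns.tendsto_atTop
  rw [← hG'.liminf_eq]
  exact liminf_le_liminf (Eventually.of_forall fun n => h _ (hs (ns n)))

/-! ### Norms on `W₀^{1,2}` -/

theorem integral_sq_eq_norm_sq {α : Type*} [MeasurableSpace α] {μ : Measure α} (f : Lp ℝ 2 μ) :
    ∫ x, f x ^ 2 ∂μ = ‖f‖ ^ 2 := by
  rw [← real_inner_self_eq_norm_sq, L2.inner_def]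
  refine integral_congr_ae (Eventually.of_forall fun x => ?_)
  simp [pow_two]

theorem normV_nonneg {d : ℕ} {Λ : Opens (Eucl d)} (u : SobolevWZero Λ) : 0 ≤ normV u :=
  Real.sqrt_nonneg _

theorem normH_nonneg {d : ℕ} {Λ : Opens (Eucl d)} (u : SobolevWZero Λ) : 0 ≤ normH u :=
  norm_nonneg _

theorem normLFour_nonneg {d : ℕ} {Λ : Opens (Eucl d)} (u : SobolevWZero Λ) : 0 ≤ normLFour u :=
  ENNReal.toReal_nonneg

theorem normV_sq {d : ℕ} {Λ : Opens (Eucl d)} (u : SobolevWZero Λ) :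
    normV u ^ 2 = ∑ i, ‖wD i u‖ ^ 2 := by
  rw [normV, Real.sq_sqrt (integral_nonneg fun x => Finset.sum_nonneg fun i _ => sq_nonneg _),
    integral_finsetSum _ fun i _ => (Lp.memLp (wD i u)).integrable_sq]
  simp_rw [integral_sq_eq_norm_sq]

theorem norm_wD_le_normV {d : ℕ} {Λ : Opens (Eucl d)} (i : Fin d) (u : SobolevWZero Λ) :
    ‖wD i u‖ ≤ normV u := by
  refine le_of_sq_le_sq ?_ (normV_nonneg u)
  rw [normV_sq]
  exact Finset.single_le_sum (f := fun i => ‖wD i u‖ ^ 2) (fun _ _ => sq_nonneg _)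
    (Finset.mem_univ i)

theorem norm_toL2_le {d : ℕ} {Λ : Opens (Eucl d)} (u : SobolevWZero Λ) : ‖toL2 u‖ ≤ ‖u‖ :=
  norm_fst_le u.1

theorem norm_wD_le {d : ℕ} {Λ : Opens (Eucl d)} (i : Fin d) (u : SobolevWZero Λ) :
    ‖wD i u‖ ≤ ‖u‖ :=
  (norm_le_pi_norm u.1.2 i).trans (norm_snd_le u.1)

/-! ### Interpolation inequalities on `W₀^{1,2}` -/

/-- The m-th root of the right-hand side is continuous in the W^{1,2} data, so the bound survives
the closure; raising to the power m recovers it. The factor (d²)^j comes from ∑‖D_iu‖ ≤ d‖u‖_V. Used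
with (m, j) = (4, 1) and (8, 3). -/
theorem memLp_four_and_normLFour_pow_le {d : ℕ} {Λ : Opens (Eucl d)} {C : ℝ≥0} {m j : ℕ}
    (hm : m ≠ 0)
    (h : ∀ p ∈ testSubspace Λ, eLpNorm p.1 4 (lebOn Λ) ^ m ≤
      C * (ENNReal.ofReal (‖p.1‖ ^ 2) * ENNReal.ofReal ((∑ i, ‖p.2 i‖) ^ 2) ^ j))
    (u : SobolevWZero Λ) : MemLp (toL2 u) 4 (lebOn Λ) ∧
      normLFour u ^ m ≤ C * (d ^ 2) ^ j * (normH u ^ 2 * (normV u ^ 2) ^ j) := by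
  let G : ℝ → ℝ → ℝ := fun a s => C * (a ^ 2 * (s ^ 2) ^ j)
  have hG0 : ∀ a s, 0 ≤ G a s := fun a s => by positivity
  let F : ℝ → ℝ → ℝ := fun a s => G a s ^ (m : ℝ)⁻¹
  have hF0 : ∀ a s, 0 ≤ F a s := fun a s => Real.rpow_nonneg (hG0 a s) _
  have hFm : ∀ a s, F a s ^ m = G a s := fun a s => Real.rpow_inv_natCast_pow (hG0 a s) hm
  have hFc : Continuous fun q : ℝ × ℝ => F q.1 q.2 := by
    refine Continuous.rpow_const (by fun_prop) fun q => Or.inr (by positivity)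
  have key := eLpNorm_four_le_of_mem_closure hFc (fun p hp => by
    have h1 := h p hp
    refine (ENNReal.pow_le_pow_left_iff hm).1 (h1.trans (le_of_eq ?_))
    rw [← ENNReal.ofReal_pow (hF0 _ _), hFm]
    simp only [G]
    rw [ENNReal.ofReal_mul C.coe_nonneg,
      ENNReal.ofReal_mul (by positivity), ENNReal.ofReal_pow (sq_nonneg _),
      ENNReal.ofReal_coe_nnreal]) u.2.2
  refine ⟨⟨(Lp.memLp (toL2 u)).1, key.trans_lt ENNReal.ofReal_lt_top⟩, ?_⟩
  have hs : ∑ i, ‖u.1.2 i‖ ≤ d * normV u := by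
    refine (Finset.sum_le_card_nsmul _ _ (normV u) fun i _ => norm_wD_le_normV i u).trans_eq ?_
    simp
  have h2 : normLFour u ≤ F ‖toL2 u‖ (∑ i, ‖u.1.2 i‖) := ENNReal.toReal_le_of_le_ofReal (hF0 _ _) key
  calc normLFour u ^ m ≤ F ‖toL2 u‖ (∑ i, ‖u.1.2 i‖) ^ m :=
        pow_le_pow_left₀ (normLFour_nonneg u) h2 m
    _ = C * (normH u ^ 2 * ((∑ i, ‖u.1.2 i‖) ^ 2) ^ j) := hFm _ _
    _ ≤ C * (normH u ^ 2 * ((d * normV u) ^ 2) ^ j) := by gcongr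
    _ = _ := by rw [mul_pow, mul_pow]; ring

theorem exists_normLFour_pow_four_le {d : ℕ} (hd : 1 ≤ d) (hd3 : d < 3) (Λ : Opens (Eucl d))
    (hΛ : Bornology.IsBounded (Λ : Set (Eucl d))) : ∃ C : ℝ, 0 ≤ C ∧ ∀ u : SobolevWZero Λ,
      MemLp (toL2 u) 4 (lebOn Λ) ∧ normLFour u ^ 4 ≤ C * (normH u ^ 2 * normV u ^ 2) := by
  obtain ⟨C, hC⟩ : ∃ C : ℝ≥0, ∀ φ : 𝓓(Λ, ℝ), ∫⁻ x, ‖φ x‖ₑ ^ 4 ≤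
      C * ((∫⁻ x, ‖φ x‖ₑ ^ 2) * ∫⁻ x, ‖fderiv ℝ φ x‖ₑ ^ 2) := by
    have hd' : d = 1 ∨ d = 2 := by omega
    obtain rfl | rfl := hd'
    -- Only in dimension one does the interpolation constant involve |Λ|.
    · refine ⟨(volume (Λ : Set (Eucl 1))).toNNReal, fun φ => ?_⟩
      rw [ENNReal.coe_toNNReal hΛ.measure_lt_top.ne]
      exact lintegral_enorm_pow_four_le_one (φ.contDiff.of_le (by exact_mod_cast le_top))
        φ.hasCompactSupport φ.tsupport_subset
    · obtain ⟨C, hC⟩ := exists_lintegral_enorm_pow_four_le_two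
      exact ⟨C, fun φ => hC φ (φ.contDiff.of_le (by exact_mod_cast le_top)) φ.hasCompactSupport⟩
  refine ⟨C * (d ^ 2) ^ 1, by positivity, fun u => ?_⟩
  have := memLp_four_and_normLFour_pow_le (C := C) (m := 4) (j := 1) four_ne_zero (fun p hp => by
    obtain ⟨φ, h4, h2, hD⟩ := exists_testFun_of_mem_testSubspace hp
    rw [← h4, ← h2, pow_one]
    exact (hC φ).trans (by gcongr)) u
  simpa only [pow_one] using this

theorem exists_normLFour_pow_eight_le (Λ : Opens (Eucl 3)) :
    ∃ C : ℝ, 0 ≤ C ∧ ∀ u : SobolevWZero Λ,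
      MemLp (toL2 u) 4 (lebOn Λ) ∧ normLFour u ^ 8 ≤ C * (normH u ^ 2 * normV u ^ 6) := by
  obtain ⟨C, hC⟩ := exists_sq_lintegral_enorm_pow_four_le_three
  refine ⟨C * ((3 : ℕ) ^ 2) ^ 3, by positivity, fun u => ?_⟩
  have := memLp_four_and_normLFour_pow_le (C := C) (m := 8) (j := 3) (by norm_num) (fun p hp => by
    obtain ⟨φ, h4, h2, hD⟩ := exists_testFun_of_mem_testSubspace hp
    rw [← h2, show 8 = 4 * 2 from rfl, pow_mul, ← h4]
    exact (hC φ (φ.contDiff.of_le (by exact_mod_cast le_top)) φ.hasCompactSupport).trans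
      (by gcongr)) u
  simpa only [← pow_mul] using this

/-- `V ⊆ L⁴`, and the square of the `L⁴` norm can be absorbed into the squared `V` norm at the cost
of a multiple of the squared `H` norm; `k` is the power at which a factor in front of the `L⁴` norm
enters. -/
def LFourAbsorption {d : ℕ} (Λ : Opens (Eucl d)) (k : ℕ) : Prop :=
  (∀ u : SobolevWZero Λ, MemLp (toL2 u) 4 (lebOn Λ)) ∧
    ∀ ε : ℝ, 0 < ε → ∃ K : ℝ, 0 ≤ K ∧ ∀ (u : SobolevWZero Λ) (t : ℝ), 0 ≤ t →
      t * normLFour u ^ 2 ≤ ε * normV u ^ 2 + K * t ^ k * normH u ^ 2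

/-- Young's inequality in the form 4ab ≤ (a + b)², with a = ε‖u‖_V² and b = Kt²‖u‖_H²; K = C/(4ε)
makes 4ab equal to the interpolation bound. -/
theorem lFourAbsorption_two {d : ℕ} (hd : 1 ≤ d) (hd3 : d < 3) (Λ : Opens (Eucl d))
    (hΛ : Bornology.IsBounded (Λ : Set (Eucl d))) : LFourAbsorption Λ 2 := by
  obtain ⟨C, hC0, hC⟩ := exists_normLFour_pow_four_le hd hd3 Λ hΛ
  refine ⟨fun u => (hC u).1, fun ε hε => ⟨C / (4 * ε), by positivity, fun u t ht => ?_⟩⟩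
  refine le_of_sq_le_sq ?_ (by positivity)
  calc (t * normLFour u ^ 2) ^ 2 = t ^ 2 * normLFour u ^ 4 := by ring
    _ ≤ t ^ 2 * (C * (normH u ^ 2 * normV u ^ 2)) := by gcongr; exact (hC u).2
    _ = 4 * (ε * normV u ^ 2) * (C / (4 * ε) * t ^ 2 * normH u ^ 2) := by field_simp
    _ ≤ _ := by nlinarith [sq_nonneg (ε * normV u ^ 2 - C / (4 * ε) * t ^ 2 * normH u ^ 2)]

/-- As for k = 2, with 4a³b ≤ (a + b)⁴, a = ε‖u‖_V² and b = Kt⁴‖u‖_H²; hence K = C/(4ε³). -/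
theorem lFourAbsorption_four (Λ : Opens (Eucl 3)) : LFourAbsorption Λ 4 := by
  obtain ⟨C, hC0, hC⟩ := exists_normLFour_pow_eight_le Λ
  refine ⟨fun u => (hC u).1, fun ε hε => ⟨C / (4 * ε ^ 3), by positivity, fun u t ht => ?_⟩⟩
  have hab : ∀ a b : ℝ, 0 ≤ a → 0 ≤ b → 4 * a ^ 3 * b ≤ (a + b) ^ 4 := fun a b ha hb => by
    have : 0 ≤ a ^ 4 + 6 * a ^ 2 * b ^ 2 + 4 * a * b ^ 3 + b ^ 4 := by positivity
    linarith [show (a + b) ^ 4 = 4 * a ^ 3 * b + (a ^ 4 + 6 * a ^ 2 * b ^ 2 + 4 * a * b ^ 3 + b ^ 4)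
      by ring]
  refine le_of_pow_le_pow_left₀ four_ne_zero (by positivity) ?_
  calc (t * normLFour u ^ 2) ^ 4 = t ^ 4 * normLFour u ^ 8 := by ring
    _ ≤ t ^ 4 * (C * (normH u ^ 2 * normV u ^ 6)) := by gcongr; exact (hC u).2
    _ = 4 * (ε * normV u ^ 2) ^ 3 * (C / (4 * ε ^ 3) * t ^ 4 * normH u ^ 2) := by field_simp
    _ ≤ _ := hab _ _ (by positivity) (by positivity)

/-! ### The operators -/

theorem abs_integral_mul_le {α : Type*} [MeasurableSpace α] {μ : Measure α} {f g : α → ℝ}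
    (hf : MemLp f 2 μ) (hg : MemLp g 2 μ) :
    |∫ x, f x * g x ∂μ| ≤ (eLpNorm f 2 μ).toReal * (eLpNorm g 2 μ).toReal := by
  have h := abs_real_inner_le_norm (hf.toLp f) (hg.toLp g)
  rw [Lp.norm_toLp, Lp.norm_toLp, L2.inner_def] at h
  refine le_trans (le_of_eq ?_) h
  congr 1
  refine integral_congr_ae ?_
  filter_upwards [hf.coeFn_toLp, hg.coeFn_toLp] with x h1 h2
  simp [h1, h2, mul_comm]

theorem memLp_two_mul_of_memLp_four {α : Type*} [MeasurableSpace α] {μ : Measure α} {f g : α → ℝ}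
    (hf : MemLp f 4 μ) (hg : MemLp g 4 μ) : MemLp (fun x => f x * g x) 2 μ ∧
      eLpNorm (fun x => f x * g x) 2 μ ≤ eLpNorm f 4 μ * eLpNorm g 4 μ := by
  have : ENNReal.HolderTriple 4 4 2 := ⟨by
    rw [← ENNReal.toReal_eq_toReal_iff' (by finiteness) (by finiteness),
      ENNReal.toReal_add (by finiteness) (by finiteness)]
    norm_num⟩
  have h : eLpNorm (f • g) 2 μ ≤ eLpNorm f 4 μ * eLpNorm g 4 μ :=
    eLpNorm_smul_le_mul_eLpNorm hg.1 hf.1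
  exact ⟨MemLp.mul' hg hf, h⟩

/-- The map `u ↦ D_i u` as a continuous linear map. -/
noncomputable def wDL {d : ℕ} (Λ : Opens (Eucl d)) (i : Fin d) : SobolevWZero Λ →L[ℝ] LTwo Λ :=
  ContinuousLinearMap.proj i ∘L ContinuousLinearMap.snd ℝ (LTwo Λ) (Fin d → LTwo Λ) ∘L
    (SobolevWZero Λ).subtypeL

theorem wDL_apply {d : ℕ} {Λ : Opens (Eucl d)} (i : Fin d) (u : SobolevWZero Λ) :
    wDL Λ i u = wD i u := rfl

theorem integral_sum_wD_mul {d : ℕ} {Λ : Opens (Eucl d)} (u w : SobolevWZero Λ) :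
    ∫ x, ∑ i, wD i u x * wD i w x ∂(lebOn Λ) = ∑ i, inner ℝ (wD i u) (wD i w) := by
  have hint : ∀ i, Integrable (fun x => wD i u x * wD i w x) (lebOn Λ) :=
    fun i => (Lp.memLp (wD i u)).integrable_mul (Lp.memLp (wD i w))
  rw [integral_finsetSum _ fun i _ => hint i]
  refine Finset.sum_congr rfl fun i _ => ?_
  rw [L2.inner_def]
  refine integral_congr_ae (Eventually.of_forall fun x => ?_)
  simp [mul_comm]

/-- Coefficients `b_i(u)` that act boundedly from `V` to `L²` by multiplication define an operator
`Δ + ∑ b_i(u) D_i` from `V` to `V^*`. -/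
theorem exists_isDriftLaplacian {d : ℕ} {Λ : Opens (Eucl d)}
    {b : SobolevWZero Λ → Fin d → Eucl d → ℝ}
    (hb : ∀ u i, ∃ C : ℝ, 0 ≤ C ∧ ∀ w : SobolevWZero Λ,
      MemLp (fun x => b u i x * toL2 w x) 2 (lebOn Λ) ∧
      eLpNorm (fun x => b u i x * toL2 w x) 2 (lebOn Λ) ≤ ENNReal.ofReal (C * ‖w‖)) :
    ∃ A, IsDriftLaplacian Λ b A := by
  choose C hC0 hC using hb
  -- Regrouped as a product of two L² functions, D_iu and b_i(u)w.
  have hcomm : ∀ u i (w : SobolevWZero Λ), (fun x => b u i x * wD i u x * toL2 w x) =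
      fun x => wD i u x * (b u i x * toL2 w x) := fun u i w => by ext x; ring
  have hint : ∀ u i (w : SobolevWZero Λ),
      Integrable (fun x => b u i x * wD i u x * toL2 w x) (lebOn Λ) := fun u i w => by
    rw [hcomm]; exact (Lp.memLp (wD i u)).integrable_mul (hC u i w).1
  let T : SobolevWZero Λ → Fin d → SobolevDual Λ := fun u i =>
    LinearMap.mkContinuous
      { toFun := fun w => ∫ x, b u i x * wD i u x * toL2 w x ∂(lebOn Λ)
        map_add' := fun w z => by
          rw [← integral_add (hint u i w) (hint u i z)]
          refine integral_congr_ae ?_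
          filter_upwards [Lp.coeFn_add (toL2 w) (toL2 z)] with x hx
          rw [show toL2 (w + z) = toL2 w + toL2 z from rfl, hx, Pi.add_apply, mul_add]
        map_smul' := fun c w => by
          rw [RingHom.id_apply, smul_eq_mul, ← integral_const_mul]
          refine integral_congr_ae ?_
          filter_upwards [Lp.coeFn_smul c (toL2 w)] with x hx
          rw [show toL2 (c • w) = c • toL2 w from rfl, hx, Pi.smul_apply, smul_eq_mul]
          ring }
      (‖wD i u‖ * C u i) fun w => by
        change |∫ x, b u i x * wD i u x * toL2 w x ∂(lebOn Λ)| ≤ _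
        rw [hcomm]
        refine (abs_integral_mul_le (Lp.memLp (wD i u)) (hC u i w).1).trans ?_
        rw [← Lp.norm_def, mul_assoc]
        gcongr
        exact ENNReal.toReal_le_of_le_ofReal (mul_nonneg (hC0 u i) (norm_nonneg w)) (hC u i w).2
  refine ⟨fun u => -(∑ i, innerSL ℝ (wD i u) ∘L wDL Λ i) + ∑ i, T u i, fun u w =>
    ⟨fun i => hint u i w, ?_⟩⟩
  rw [integral_sum_wD_mul]
  simp only [_root_.add_apply, _root_.neg_apply,
    _root_.sum_apply, ContinuousLinearMap.comp_apply, innerSL_apply_apply, wDL_apply]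
  rfl

/-! ### Monotonicity estimates -/

/-- Pointwise control of the difference of the drift terms, integrated. -/
theorem IsDriftLaplacian.two_mul_sub_le {d : ℕ} {Λ : Opens (Eucl d)}
    {b : SobolevWZero Λ → Fin d → Eucl d → ℝ} {A : SobolevWZero Λ → SobolevDual Λ}
    (h : IsDriftLaplacian Λ b A) (u v : SobolevWZero Λ) {G : Fin d → Eucl d → ℝ}
    (hG : ∀ i, Integrable (G i) (lebOn Λ))
    (hle : ∀ i, ∀ᵐ x ∂(lebOn Λ), 2 * (b u i x * wD i u x - b v i x * wD i v x) * (toL2 (u - v) x) ≤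
      1 / 2 * (wD i (u - v) x) ^ 2 + G i x) :
    2 * (A u - A v) (u - v) ≤ -(3 / 2) * normV (u - v) ^ 2 + ∑ i, ∫ x, G i x ∂(lebOn Λ) := by
  obtain ⟨hu, hAu⟩ := h u (u - v)
  obtain ⟨hv, hAv⟩ := h v (u - v)
  have h1 : ∀ i, 2 * (∫ x, b u i x * wD i u x * toL2 (u - v) x ∂(lebOn Λ) -
      ∫ x, b v i x * wD i v x * toL2 (u - v) x ∂(lebOn Λ)) ≤
      1 / 2 * ‖wD i (u - v)‖ ^ 2 + ∫ x, G i x ∂(lebOn Λ) := fun i => by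
    have hsq := (Lp.memLp (wD i (u - v))).integrable_sq.const_mul (1 / 2)
    rw [← integral_sub (hu i) (hv i), ← integral_const_mul, ← integral_sq_eq_norm_sq,
      ← integral_const_mul, ← integral_add hsq (hG i)]
    refine integral_mono_ae (((hu i).sub (hv i)).const_mul 2) (hsq.add (hG i)) ?_
    filter_upwards [hle i] with x hx
    refine le_trans (le_of_eq ?_) hx
    ring
  -- The Laplacian supplies -2‖u - v‖_V²; the ½ spent pointwise in `hle` leaves -3/2.
  have h2 : ∑ i, inner ℝ (wD i u) (wD i (u - v)) - ∑ i, inner ℝ (wD i v) (wD i (u - v)) =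
      normV (u - v) ^ 2 := by
    rw [normV_sq, ← Finset.sum_sub_distrib]
    refine Finset.sum_congr rfl fun i _ => ?_
    rw [← inner_sub_left, show wD i u - wD i v = wD i (u - v) from rfl, real_inner_self_eq_norm_sq]
  have h3 := Finset.sum_le_sum fun i (_ : i ∈ Finset.univ) => h1 i
  rw [← Finset.mul_sum, Finset.sum_sub_distrib, Finset.sum_add_distrib, ← Finset.mul_sum,
    ← normV_sq] at h3
  rw [_root_.sub_apply, hAu, hAv, integral_sum_wD_mul, integral_sum_wD_mul]
  linarith

/-- From ap - a'p' = a(p - p') + (a - a')p', with Young's inequality on the first term only. This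
asymmetric splitting is why the final bounds involve u through its L⁴ norm and v through its
gradient. -/
theorem two_mul_drift_sub_le {a a' p p' w β : ℝ} (ha : a ^ 2 ≤ β) :
    2 * (a * p - a' * p') * w ≤ 1 / 2 * (p - p') ^ 2 + (2 * β * w ^ 2 + 2 * |a - a'| * |p'| * |w|) := by
  have h1 : (a - a') * p' * w ≤ |a - a'| * |p'| * |w| := by
    rw [← abs_mul, ← abs_mul]; exact le_abs_self _
  have h2 : a ^ 2 * w ^ 2 ≤ β * w ^ 2 := by gcongr
  nlinarith [sq_nonneg (p - p' - 2 * a * w)]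

theorem wD_sub_ae {d : ℕ} {Λ : Opens (Eucl d)} (i : Fin d) (u v : SobolevWZero Λ) :
    ∀ᵐ x ∂(lebOn Λ), wD i (u - v) x = wD i u x - wD i v x := by
  filter_upwards [Lp.coeFn_sub (wD i u) (wD i v)] with x hx
  rwa [Pi.sub_apply] at hx

theorem toL2_sub_ae {d : ℕ} {Λ : Opens (Eucl d)} (u v : SobolevWZero Λ) :
    ∀ᵐ x ∂(lebOn Λ), toL2 (u - v) x = toL2 u x - toL2 v x := by
  filter_upwards [Lp.coeFn_sub (toL2 u) (toL2 v)] with x hx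
  rwa [Pi.sub_apply] at hx

theorem memLp_sq_of_memLp_four {α : Type*} [MeasurableSpace α] {μ : Measure α} {f : α → ℝ}
    (hf : MemLp f 4 μ) : MemLp (fun x => f x ^ 2) 2 μ ∧
      (eLpNorm (fun x => f x ^ 2) 2 μ).toReal ≤ (eLpNorm f 4 μ).toReal ^ 2 := by
  obtain ⟨h1, h2⟩ := memLp_two_mul_of_memLp_four hf hf
  simp_rw [← pow_two] at h1 h2
  refine ⟨h1, ?_⟩
  rw [← ENNReal.toReal_pow]
  exact ENNReal.toReal_mono (ENNReal.pow_ne_top hf.2.ne) h2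

theorem integral_sq_mul_sq_le {α : Type*} [MeasurableSpace α] {μ : Measure α} {f g : α → ℝ}
    (hf : MemLp f 4 μ) (hg : MemLp g 4 μ) : Integrable (fun x => f x ^ 2 * g x ^ 2) μ ∧
      ∫ x, f x ^ 2 * g x ^ 2 ∂μ ≤ (eLpNorm f 4 μ).toReal ^ 2 * (eLpNorm g 4 μ).toReal ^ 2 := by
  obtain ⟨mf, nf⟩ := memLp_sq_of_memLp_four hf
  obtain ⟨mg, ng⟩ := memLp_sq_of_memLp_four hg
  refine ⟨mf.integrable_mul mg, (le_abs_self _).trans ((abs_integral_mul_le mf mg).trans ?_)⟩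
  gcongr

theorem integral_abs_mul_sq_le {α : Type*} [MeasurableSpace α] {μ : Measure α} {f g : α → ℝ}
    (hf : MemLp f 2 μ) (hg : MemLp g 4 μ) : Integrable (fun x => |f x| * g x ^ 2) μ ∧
      ∫ x, |f x| * g x ^ 2 ∂μ ≤ (eLpNorm f 2 μ).toReal * (eLpNorm g 4 μ).toReal ^ 2 := by
  have mf : MemLp (fun x => |f x|) 2 μ := hf.norm
  obtain ⟨mg, ng⟩ := memLp_sq_of_memLp_four hg
  refine ⟨mf.integrable_mul mg, (le_abs_self _).trans ((abs_integral_mul_le mf mg).trans ?_)⟩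
  rw [eLpNorm_congr_norm_ae (g := f) (Eventually.of_forall fun x => by simp)]
  gcongr

/-- Hölder's inequality for the terms left by the pointwise estimate: exponents (4, 4, 4, 4) for
u²w² and (2, 4, 4) for |D_iv|w². -/
theorem integral_drift_bound_le {d : ℕ} {Λ : Opens (Eucl d)} {u v w : SobolevWZero Λ}
    (hu : MemLp (toL2 u) 4 (lebOn Λ)) (hw : MemLp (toL2 w) 4 (lebOn Λ)) (i : Fin d)
    {a b c : ℝ} (hb : 0 ≤ b) (hc : 0 ≤ c) :
    Integrable (fun x => a * toL2 w x ^ 2 + b * (toL2 u x ^ 2 * toL2 w x ^ 2) +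
      c * (|wD i v x| * toL2 w x ^ 2)) (lebOn Λ) ∧
    ∫ x, (a * toL2 w x ^ 2 + b * (toL2 u x ^ 2 * toL2 w x ^ 2) +
      c * (|wD i v x| * toL2 w x ^ 2)) ∂(lebOn Λ) ≤
      a * normH w ^ 2 + b * (normLFour u ^ 2 * normLFour w ^ 2) +
        c * (normV v * normLFour w ^ 2) := by
  obtain ⟨j2, e2⟩ := integral_sq_mul_sq_le hu hw
  obtain ⟨j3, e3⟩ := integral_abs_mul_sq_le (Lp.memLp (wD i v)) hw
  rw [← Lp.norm_def] at e3
  have i1 : Integrable (fun x => a * toL2 w x ^ 2) (lebOn Λ) :=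
    (Lp.memLp (toL2 w)).integrable_sq.const_mul _
  have i2 : Integrable (fun x => b * (toL2 u x ^ 2 * toL2 w x ^ 2)) (lebOn Λ) := j2.const_mul _
  have i3 : Integrable (fun x => c * (|wD i v x| * toL2 w x ^ 2)) (lebOn Λ) := j3.const_mul _
  have i12 : Integrable (fun x => a * toL2 w x ^ 2 + b * (toL2 u x ^ 2 * toL2 w x ^ 2))
    (lebOn Λ) := i1.add i2
  refine ⟨i12.add i3, ?_⟩
  rw [integral_add i12 i3, integral_add i1 i2, integral_const_mul,
    integral_const_mul, integral_const_mul, integral_sq_eq_norm_sq]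
  have e4 : ‖wD i v‖ * normLFour w ^ 2 ≤ normV v * normLFour w ^ 2 := by
    gcongr; exact norm_wD_le_normV i v
  exact add_le_add (add_le_add le_rfl (mul_le_mul_of_nonneg_left e2 hb))
    (mul_le_mul_of_nonneg_left (e3.trans e4) hc)

/-- Monotonicity for `A(u) = Δu + ∑ f_i(u) D_i u` when `f_i` is Lipschitz of growth
`f_i(r)² ≤ α + β r²`. -/
theorem IsDriftLaplacian.exists_bound_of_lipschitz {d : ℕ} {Λ : Opens (Eucl d)} {k : ℕ}
    (hk : LFourAbsorption Λ k) {f : Fin d → ℝ → ℝ} {L : ℝ≥0} (hf : ∀ i, LipschitzWith L (f i))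
    {α β : ℝ} (hα : 0 ≤ α) (hβ : 0 ≤ β) (hfb : ∀ i r, f i r ^ 2 ≤ α + β * r ^ 2)
    {A : SobolevWZero Λ → SobolevDual Λ}
    (hA : IsDriftLaplacian Λ (fun u i x => f i (toL2 u x)) A) :
    ∃ K : ℝ, 0 ≤ K ∧ ∀ u v : SobolevWZero Λ, 2 * (A u - A v) (u - v) ≤ - normV (u - v) ^ 2 +
      (K + K * β ^ k * normLFour u ^ (2 * k) + K * normV v ^ k) * normH (u - v) ^ 2 := by
  -- Absorption is applied twice, to the u term and to the v term, which spends 2·¼ of the available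
  -- 3/2 and leaves the coefficient -1.
  obtain ⟨K, hK0, hK⟩ := hk.2 (1 / 4) (by norm_num)
  -- One summand for each of the α, u and v terms. The factor β^k stays outside so that β = 0
  -- removes the L⁴ norm of u.
  refine ⟨2 * d * α + K * (2 * d) ^ k + K * (2 * d * L) ^ k, by positivity, fun u v => ?_⟩
  have hGi := fun i => integral_drift_bound_le (v := v) (hk.1 u) (hk.1 (u - v)) i
    (a := 2 * α) (b := 2 * β) (c := 2 * L) (by positivity) (by positivity)
  have key := hA.two_mul_sub_le u v
    (G := fun i x => 2 * α * toL2 (u - v) x ^ 2 + 2 * β * (toL2 u x ^ 2 * toL2 (u - v) x ^ 2) +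
      2 * L * (|wD i v x| * toL2 (u - v) x ^ 2))
    (fun i => (hGi i).1) (fun i => by
      filter_upwards [wD_sub_ae i u v, toL2_sub_ae u v] with x h1 h2
      rw [h1]
      refine (two_mul_drift_sub_le (hfb i _)).trans (add_le_add_right ?_ _)
      have hL : |f i (toL2 u x) - f i (toL2 v x)| ≤ L * |toL2 (u - v) x| := by
        rw [h2]; exact (hf i).dist_le_mul _ _
      calc _ ≤ 2 * (α + β * toL2 u x ^ 2) * toL2 (u - v) x ^ 2 +
            2 * (L * |toL2 (u - v) x|) * |wD i v x| * |toL2 (u - v) x| := by gcongr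
        _ = _ := by rw [← sq_abs (toL2 (u - v) x)]; ring)
  have hsum := Finset.sum_le_sum fun i (_ : i ∈ Finset.univ) => (hGi i).2
  rw [Finset.sum_const, Finset.card_univ, Fintype.card_fin, nsmul_eq_mul] at hsum
  have a1 := hK (u - v) (2 * d * β * normLFour u ^ 2) (by positivity)
  have a2 := hK (u - v) (2 * d * L * normV v) (mul_nonneg (by positivity) (normV_nonneg v))
  have hn4 : 0 ≤ normLFour u ^ (2 * k) := pow_nonneg (normLFour_nonneg u) _
  have hnV : 0 ≤ normV v ^ k := pow_nonneg (normV_nonneg v) _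
  have r1 : K * (2 * d * β * normLFour u ^ 2) ^ k * normH (u - v) ^ 2 =
      K * (2 * d) ^ k * β ^ k * normLFour u ^ (2 * k) * normH (u - v) ^ 2 := by
    rw [mul_pow, mul_pow, ← pow_mul]; ring
  have r2 : K * (2 * d * L * normV v) ^ k * normH (u - v) ^ 2 =
      K * (2 * d * L) ^ k * normV v ^ k * normH (u - v) ^ 2 := by
    rw [mul_pow (2 * d * L : ℝ)]; ring
  rw [r1] at a1
  rw [r2] at a2
  have c1 : K * (2 * d) ^ k * β ^ k * normLFour u ^ (2 * k) * normH (u - v) ^ 2 ≤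
      (2 * d * α + K * (2 * d) ^ k + K * (2 * d * L) ^ k) * β ^ k * normLFour u ^ (2 * k) *
        normH (u - v) ^ 2 := by
    gcongr
    have : 0 ≤ 2 * d * α + K * (2 * d * L) ^ k := by positivity
    linarith
  have c2 : K * (2 * d * L) ^ k * normV v ^ k * normH (u - v) ^ 2 ≤
      (2 * d * α + K * (2 * d) ^ k + K * (2 * d * L) ^ k) * normV v ^ k * normH (u - v) ^ 2 := by
    gcongr
    have : 0 ≤ 2 * d * α + K * (2 * d) ^ k := by positivity
    linarith
  have c3 : 2 * d * α * normH (u - v) ^ 2 ≤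
      (2 * d * α + K * (2 * d) ^ k + K * (2 * d * L) ^ k) * normH (u - v) ^ 2 := by
    gcongr
    have : 0 ≤ K * (2 * d) ^ k + K * (2 * d * L) ^ k := by positivity
    linarith
  nlinarith

/-- Continuity of V ⊆ L⁴ in the W^{1,2} norm: the absorption inequality with ε = t = 1. -/
theorem LFourAbsorption.exists_normLFour_le {d : ℕ} {Λ : Opens (Eucl d)} {k : ℕ}
    (hk : LFourAbsorption Λ k) :
    ∃ C : ℝ, 0 ≤ C ∧ ∀ u : SobolevWZero Λ, normLFour u ≤ C * ‖u‖ := by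
  obtain ⟨K, hK0, hK⟩ := hk.2 1 one_pos
  refine ⟨Real.sqrt (d + K), Real.sqrt_nonneg _, fun u => le_of_sq_le_sq ?_ (by positivity)⟩
  have h1 := hK u 1 zero_le_one
  have h2 : normV u ^ 2 ≤ d * ‖u‖ ^ 2 := by
    rw [normV_sq]
    refine (Finset.sum_le_card_nsmul _ _ (‖u‖ ^ 2) fun i _ => ?_).trans_eq (by simp)
    gcongr
    exact norm_wD_le i u
  have h3 : K * normH u ^ 2 ≤ K * ‖u‖ ^ 2 := by
    have := normH_nonneg u
    gcongr
    exact norm_toL2_le u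
  rw [mul_pow, Real.sq_sqrt (by positivity)]
  simp only [one_pow, one_mul, mul_one] at h1
  linarith

/-- Linear growth puts f_i(u) in L⁴, so multiplication by f_i(u) maps V ⊆ L⁴ boundedly into L². -/
theorem exists_isDriftLaplacian_of_lipschitz {d : ℕ} {Λ : Opens (Eucl d)}
    (hΛ : Bornology.IsBounded (Λ : Set (Eucl d))) {k : ℕ} (hk : LFourAbsorption Λ k)
    {f : Fin d → ℝ → ℝ} {L : ℝ≥0} (hf : ∀ i, LipschitzWith L (f i)) :
    ∃ A, IsDriftLaplacian Λ (fun u i x => f i (toL2 u x)) A := by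
  -- Finite measure puts the constants |f_i(0)| in L⁴.
  have : IsFiniteMeasure (lebOn Λ) := isFiniteMeasure_restrict.2 hΛ.measure_lt_top.ne
  obtain ⟨C, hC0, hC⟩ := hk.exists_normLFour_le
  have hF : ∀ u i, MemLp (fun x => f i (toL2 u x)) 4 (lebOn Λ) := fun u i => by
    have h0 : MemLp (fun x => ‖toL2 u x‖) 4 (lebOn Λ) := (hk.1 u).norm
    have h0' : MemLp (fun x => L * ‖toL2 u x‖) 4 (lebOn Λ) := h0.const_mul (L : ℝ)
    have hc : MemLp (fun _ => |f i 0|) 4 (lebOn Λ) := memLp_const _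
    have h1 : MemLp (fun x => |f i 0| + L * ‖toL2 u x‖) 4 (lebOn Λ) := hc.add h0'
    refine h1.mono' ((hf i).continuous.comp_aestronglyMeasurable (hk.1 u).1)
      (Eventually.of_forall fun x => ?_)
    have h2 := (hf i).dist_le_mul (toL2 u x) 0
    rw [dist_zero_right, Real.dist_eq] at h2
    have h3 := abs_add_le (f i (toL2 u x) - f i 0) (f i 0)
    rw [sub_add_cancel] at h3
    rw [Real.norm_eq_abs]
    linarith
  refine exists_isDriftLaplacian fun u i =>
    ⟨(eLpNorm (fun x => f i (toL2 u x)) 4 (lebOn Λ)).toReal * C,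
      mul_nonneg ENNReal.toReal_nonneg hC0, fun w => ?_⟩
  obtain ⟨h1, h2⟩ := memLp_two_mul_of_memLp_four (hF u i) (hk.1 w)
  refine ⟨h1, h2.trans ?_⟩
  rw [mul_assoc, ENNReal.ofReal_mul ENNReal.toReal_nonneg, ENNReal.ofReal_toReal (hF u i).2.ne]
  gcongr
  exact ENNReal.le_ofReal_iff_toReal_le (hk.1 w).2.ne (by positivity) |>.2 (hC w)

/-- Existence and monotonicity of `A(u) = Δu + ∑ f_i(u) D_i u` for Lipschitz `f_i`. -/
theorem exists_isDriftLaplacian_bound_of_lipschitz {d : ℕ} {Λ : Opens (Eucl d)}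
    (hΛ : Bornology.IsBounded (Λ : Set (Eucl d))) {k : ℕ} (hk0 : k ≠ 0) (hk : LFourAbsorption Λ k)
    {f : Fin d → ℝ → ℝ} (hf : ∀ i, ∃ L : ℝ≥0, LipschitzWith L (f i)) :
    ∃ A : SobolevWZero Λ → SobolevDual Λ,
      IsDriftLaplacian Λ (fun u i x => f i (toL2 u x)) A ∧
      (∃ K : ℝ, ∀ u v : SobolevWZero Λ, 2 * (A u - A v) (u - v) ≤ - normV (u - v) ^ 2 +
          (K + K * normLFour u ^ (2 * k) + K * normV v ^ k) * normH (u - v) ^ 2) ∧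
      ((∀ i, ∃ M : ℝ, ∀ r : ℝ, |f i r| ≤ M) →
        ∃ K : ℝ, ∀ u v : SobolevWZero Λ, 2 * (A u - A v) (u - v) ≤ - normV (u - v) ^ 2 +
          (K + K * normV v ^ k) * normH (u - v) ^ 2) := by
  choose L' hL' using hf
  obtain ⟨L, hL⟩ : ∃ L : ℝ≥0, ∀ i, LipschitzWith L (f i) :=
    ⟨∑ i, L' i, fun i => (hL' i).weaken (Finset.single_le_sum (fun _ _ => zero_le) (Finset.mem_univ i))⟩
  obtain ⟨A, hA⟩ := exists_isDriftLaplacian_of_lipschitz hΛ hk hL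
  refine ⟨A, hA, ?_, fun hM => ?_⟩
  -- (x + y)² ≤ 2x² + 2y² with x = f_i(0) and |y| ≤ L|r|.
  · have hfb : ∀ i r, f i r ^ 2 ≤ 2 * ∑ j, f j 0 ^ 2 + 2 * (L : ℝ) ^ 2 * r ^ 2 := fun i r => by
      have h1 : f i 0 ^ 2 ≤ ∑ j, f j 0 ^ 2 :=
        Finset.single_le_sum (f := fun j => f j 0 ^ 2) (fun _ _ => sq_nonneg _) (Finset.mem_univ i)
      have h2 := (hL i).dist_le_mul r 0
      rw [dist_zero_right, Real.dist_eq, Real.norm_eq_abs] at h2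
      have h3 : (f i r - f i 0) ^ 2 ≤ (L * |r|) ^ 2 := by
        rw [← sq_abs]; gcongr
      rw [mul_pow, sq_abs] at h3
      nlinarith [sq_nonneg (f i r - 2 * f i 0)]
    obtain ⟨K, hK0, hK⟩ := hA.exists_bound_of_lipschitz hk hL
      (mul_nonneg zero_le_two (Finset.sum_nonneg fun _ _ => sq_nonneg _)) (by positivity) hfb
    set B : ℝ := (2 * (L : ℝ) ^ 2) ^ k
    have hB : 0 ≤ B := by positivity
    refine ⟨K + K * B, fun u v => (hK u v).trans ?_⟩
    have h4 : 0 ≤ normLFour u ^ (2 * k) := pow_nonneg (normLFour_nonneg u) _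
    have hV : 0 ≤ normV v ^ k := pow_nonneg (normV_nonneg v) _
    have hKB : 0 ≤ K * B := by positivity
    gcongr
    · linarith
    · linarith
    · linarith
  · choose M hM using hM
    -- Boundedness permits β = 0, and 0^k = 0 because k ≠ 0.
    have hfb : ∀ i r, f i r ^ 2 ≤ ∑ j, M j ^ 2 + 0 * r ^ 2 := fun i r => by
      rw [zero_mul, add_zero, ← sq_abs]
      refine le_trans ?_ (Finset.single_le_sum (f := fun j => M j ^ 2) (fun _ _ => sq_nonneg _)
        (Finset.mem_univ i))
      gcongr
      exact hM i r
    obtain ⟨K, -, hK⟩ := hA.exists_bound_of_lipschitz hk hL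
      (Finset.sum_nonneg fun _ _ => sq_nonneg _) le_rfl hfb
    refine ⟨K, fun u v => ?_⟩
    simpa [zero_pow hk0] using hK u v

/-- Existence and monotonicity of `A(u) = Δu + ∑ f_i D_i u` for bounded measurable coefficients. -/
theorem exists_isDriftLaplacian_bound_of_bounded {d : ℕ} {Λ : Opens (Eucl d)}
    {f : Fin d → Eucl d → ℝ} (hf : ∀ i, AEStronglyMeasurable (f i) (lebOn Λ))
    (hM : ∀ i, ∃ M : ℝ, ∀ x ∈ Λ, |f i x| ≤ M) :
    ∃ A : SobolevWZero Λ → SobolevDual Λ, IsDriftLaplacian Λ (fun _ i x => f i x) A ∧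
      ∃ K : ℝ, ∀ u v : SobolevWZero Λ,
        2 * (A u - A v) (u - v) ≤ - normV (u - v) ^ 2 + K * normH (u - v) ^ 2 := by
  choose M hM using hM
  -- The bound `M i` may be negative when Λ is empty, hence the absolute value.
  have hMa : ∀ i, ∀ᵐ x ∂(lebOn Λ), |f i x| ≤ |M i| := fun i => by
    filter_upwards [ae_restrict_mem Λ.isOpen.measurableSet] with x hx
    exact (hM i x hx).trans (le_abs_self _)
  obtain ⟨A, hA⟩ := exists_isDriftLaplacian (Λ := Λ) (b := fun _ i x => f i x) fun u i =>
    ⟨|M i|, abs_nonneg _, fun w => by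
      have hle : ∀ᵐ x ∂(lebOn Λ), ‖f i x * toL2 w x‖ ≤ |M i| * ‖toL2 w x‖ := by
        filter_upwards [hMa i] with x hx
        rw [norm_mul]
        gcongr
        exact hx
      refine ⟨(Lp.memLp (toL2 w)).of_le_mul ((hf i).mul (Lp.memLp (toL2 w)).1) hle, ?_⟩
      refine (eLpNorm_le_mul_eLpNorm_of_ae_le_mul hle 2).trans ?_
      rw [ENNReal.ofReal_mul (abs_nonneg _), ← Lp.enorm_def, ← ofReal_norm]
      gcongr
      exact norm_toL2_le w⟩
  refine ⟨A, hA, ∑ i, 2 * M i ^ 2, fun u v => ?_⟩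
  -- Here a = a' in the pointwise estimate, so the term with D_iv vanishes and only 2M_i²(u - v)²
  -- remains.
  have key := hA.two_mul_sub_le u v (G := fun i x => 2 * M i ^ 2 * toL2 (u - v) x ^ 2)
    (fun i => (Lp.memLp (toL2 (u - v))).integrable_sq.const_mul _) (fun i => by
      filter_upwards [hMa i, wD_sub_ae i u v] with x h1 h2
      rw [h2]
      refine (two_mul_drift_sub_le (sq_le_sq.2 h1)).trans (le_of_eq ?_)
      simp)
  simp_rw [integral_const_mul, integral_sq_eq_norm_sq] at key
  rw [← Finset.sum_mul] at key
  refine key.trans ?_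
  have := sq_nonneg (normV (u - v))
  rw [normH]
  linarith

theorem lemma3p1 {d : ℕ} (hd : 1 ≤ d) (Λ : Opens (Eucl d))
    (hΛ : Bornology.IsBounded (Λ : Set (Eucl d))) :
    -- coefficients `f_i(u)` with Lipschitz functions `f_i : ℝ → ℝ`
    (∀ f : Fin d → ℝ → ℝ, (∀ i, ∃ L : ℝ≥0, LipschitzWith L (f i)) →
      -- dimensions one and two
      (d < 3 →
        (∀ u : SobolevWZero Λ, MemLp (toL2 u) 4 (lebOn Λ)) ∧
        ∃ A : SobolevWZero Λ → SobolevDual Λ,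
          IsDriftLaplacian Λ (fun u i x => f i (toL2 u x)) A ∧
          (∃ K : ℝ, ∀ u v : SobolevWZero Λ,
            2 * (A u - A v) (u - v) ≤ - normV (u - v) ^ 2 +
              (K + K * normLFour u ^ 4 + K * normV v ^ 2) * normH (u - v) ^ 2) ∧
          ((∀ i, ∃ M : ℝ, ∀ r : ℝ, |f i r| ≤ M) →
            ∃ K : ℝ, ∀ u v : SobolevWZero Λ,
              2 * (A u - A v) (u - v) ≤ - normV (u - v) ^ 2 +
                (K + K * normV v ^ 2) * normH (u - v) ^ 2)) ∧
      -- dimension three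
      (d = 3 →
        (∀ u : SobolevWZero Λ, MemLp (toL2 u) 4 (lebOn Λ)) ∧
        ∃ A : SobolevWZero Λ → SobolevDual Λ,
          IsDriftLaplacian Λ (fun u i x => f i (toL2 u x)) A ∧
          (∃ K : ℝ, ∀ u v : SobolevWZero Λ,
            2 * (A u - A v) (u - v) ≤ - normV (u - v) ^ 2 +
              (K + K * normLFour u ^ 8 + K * normV v ^ 4) * normH (u - v) ^ 2) ∧
          ((∀ i, ∃ M : ℝ, ∀ r : ℝ, |f i r| ≤ M) →
            ∃ K : ℝ, ∀ u v : SobolevWZero Λ,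
              2 * (A u - A v) (u - v) ≤ - normV (u - v) ^ 2 +
                (K + K * normV v ^ 4) * normH (u - v) ^ 2))) ∧
    -- bounded measurable coefficients `f_i : Λ → ℝ`
    (∀ f : Fin d → Eucl d → ℝ, (∀ i, AEStronglyMeasurable (f i) (lebOn Λ)) →
      (∀ i, ∃ M : ℝ, ∀ x ∈ Λ, |f i x| ≤ M) →
      ∃ A : SobolevWZero Λ → SobolevDual Λ,
        IsDriftLaplacian Λ (fun _ i x => f i x) A ∧
        ∃ K : ℝ, ∀ u v : SobolevWZero Λ,
          2 * (A u - A v) (u - v) ≤ - normV (u - v) ^ 2 + K * normH (u - v) ^ 2) := by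
  refine ⟨fun f hf => ⟨fun hd3 => ?_, fun hd3 => ?_⟩, fun f hf hM =>
    exists_isDriftLaplacian_bound_of_bounded hf hM⟩
  · have hk := lFourAbsorption_two hd hd3 Λ hΛ
    exact ⟨hk.1, exists_isDriftLaplacian_bound_of_lipschitz hΛ two_ne_zero hk hf⟩
  · subst hd3
    have hk := lFourAbsorption_four Λ
    exact ⟨hk.1, exists_isDriftLaplacian_bound_of_lipschitz hΛ four_ne_zero hk hf⟩
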